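/- Let $M=\mathbb C/(2\pi\mathbb Z+2\pi i\mathbb Z)$, with Lebesgue measure $L(dz)$, let $\varphi\in C^\infty(M;\mathbb R)$, and let $\tau>\max_M\varphi-\min_M\varphi$ (so that $\tau>0$). For $h>0$ let $L^2_\varphi(M)=L^2(M,e^{-2\varphi/h}L(dz))$, and let $h\overline\partial=\frac h2(\partial_x+i\partial_y)$, $z=x+iy$, act in the sense of distributions as a closed densely defined operator on $L^2_\varphi(M)$ with its maximal domain $\{u\in L^2_\varphi(M):\ h\overline\partial u\in L^2_\varphi(M)\}$. The singular values of $h\overline\partial$ are the numbers $t\ge 0$ such that $t^2$ is an eigenvalue of $(h\overline\partial)^*(h\overline\partial)$, where $^*$ is the adjoint in $L^2_\varphi(M)$; the multiplicity of $t$ is the dimension of the corresponding eigenspace. Then there exists $h_0>0$, depending on $\varphi$ and $\tau$, such that for all $0<h<h_0$ the operator $h\overline\partial:L^2_\varphi(M)\to L^2_\varphi(M)$ has precisely one singular value, counted with multiplicity, in the interval $[0,e^{-\tau/h}]$, namely $0$: it is the only singular value in this interval, and it has multiplicity one. -/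

import Mathlib

open MeasureTheory
open scoped ContDiff ENNReal

noncomputable section

namespace DbarTorus

instance fact_two_pi_pos : Fact (0 < 2 * Real.pi) := ⟨Real.two_pi_pos⟩

/-- The torus `M = ℂ / (2πℤ + 2πiℤ) = X + iY` with `X = Y = ℝ / 2πℤ`; the point `(x, y)` stands for
`z = x + iy`. Its `volume` is the Lebesgue measure `L(dz)`, of total mass `(2π)²`. -/
abbrev Torus : Type := AddCircle (2 * Real.pi) × AddCircle (2 * Real.pi)

/-- The covering map `ℝ² → M`. -/
def proj (p : ℝ × ℝ) : Torus := ((p.1 : AddCircle (2 * Real.pi)), (p.2 : AddCircle (2 * Real.pi)))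

/-- `C^∞` functions on the torus: those whose periodic lift to `ℝ²` is `C^∞`. -/
def IsSmooth {E : Type} [NormedAddCommGroup E] [NormedSpace ℝ E] (f : Torus → E) : Prop :=
  ContDiff ℝ ∞ (fun p : ℝ × ℝ => f (proj p))

/-- `∂_{\bar z} f = (∂_x f + i ∂_y f) / 2`, pointwise (used for smooth `f`). -/
def dbar (f : Torus → ℂ) (p : Torus) : ℂ :=
  (1 / 2 : ℂ) * (deriv (fun t : ℝ => f (p.1 + (t : AddCircle (2 * Real.pi)), p.2)) 0
    + Complex.I * deriv (fun t : ℝ => f (p.1, p.2 + (t : AddCircle (2 * Real.pi)))) 0)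

/-- The measure `e^{-2φ/h} L(dz)`. -/
def weightedMeasure (φ : Torus → ℝ) (h : ℝ) : Measure Torus :=
  volume.withDensity (fun z => ENNReal.ofReal (Real.exp (-2 * φ z / h)))

/-- `L²_φ(M) = e^{φ/h} L²(M)`, with `‖u‖² = ∫ |u|² e^{-2φ/h} L(dz)`. -/
abbrev L2phi (φ : Torus → ℝ) (h : ℝ) : Type := Lp ℂ 2 (weightedMeasure φ h)

/-- `h ∂_{\bar z} u = v` in the sense of distributions on the torus. -/
def HasWeakDbar (h : ℝ) (u v : Torus → ℂ) : Prop :=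
  ∀ χ : Torus → ℂ, IsSmooth χ → ∫ z, v z * χ z = -((h : ℂ) * ∫ z, u z * dbar χ z)

theorem isOpenQuotientMap_proj : IsOpenQuotientMap proj :=
  IsOpenQuotientMap.prodMap (QuotientAddGroup.isOpenQuotientMap_mk)
    (QuotientAddGroup.isOpenQuotientMap_mk)

theorem IsSmooth.continuous {E : Type} [NormedAddCommGroup E] [NormedSpace ℝ E] {f : Torus → E}
    (hf : IsSmooth f) : Continuous f :=
  isOpenQuotientMap_proj.continuous_comp_iff.1 (ContDiff.continuous hf)

theorem dbar_proj {f : Torus → ℂ} (hf : IsSmooth f) (p : ℝ × ℝ) :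
    dbar f (proj p) = (1 / 2 : ℂ) * (fderiv ℝ (fun q => f (proj q)) p (1, 0)
      + Complex.I * fderiv ℝ (fun q => f (proj q)) p (0, 1)) := by
  have hd : DifferentiableAt ℝ (fun q => f (proj q)) p :=
    (ContDiff.differentiable hf (by simp)).differentiableAt
  have key : ∀ w : ℝ × ℝ, deriv (fun t : ℝ => f (proj (p + t • w))) 0
      = fderiv ℝ (fun q => f (proj q)) p w := by
    intro w
    have h1 : HasDerivAt (fun t : ℝ => p + t • w) w 0 := by
      simpa using ((hasDerivAt_id (0 : ℝ)).smul_const w).const_add p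
    have h2 : HasFDerivAt (fun q => f (proj q)) (fderiv ℝ (fun q => f (proj q)) p)
        (p + (0 : ℝ) • w) := by simpa using hd.hasFDerivAt
    exact (h2.comp_hasDerivAt (0 : ℝ) h1).deriv
  have kx := key (1, 0)
  have ky := key (0, 1)
  simp only [proj, Prod.smul_mk, smul_eq_mul, mul_one, mul_zero, Prod.fst_add, Prod.snd_add,
    add_zero, AddCircle.coe_add] at kx ky
  simp only [dbar, proj, kx, ky]

theorem continuous_dbar {f : Torus → ℂ} (hf : IsSmooth f) : Continuous (dbar f) := by
  refine isOpenQuotientMap_proj.continuous_comp_iff.1 ?_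
  have h1 : Continuous (fderiv ℝ (fun q => f (proj q))) :=
    ContDiff.continuous_fderiv hf (by simp)
  have : dbar f ∘ proj = fun p => (1 / 2 : ℂ) * (fderiv ℝ (fun q => f (proj q)) p (1, 0)
      + Complex.I * fderiv ℝ (fun q => f (proj q)) p (0, 1)) := funext (dbar_proj hf)
  rw [this]
  fun_prop

theorem weight_bounds {φ : Torus → ℝ} (hφ : Continuous φ) (h : ℝ) :
    ∃ c : ℝ≥0∞, c ≠ ⊤ ∧ (volume : Measure Torus) ≤ c • weightedMeasure φ h := by
  have hc : Continuous (fun z => Real.exp (2 * φ z / h)) := by fun_prop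
  obtain ⟨B, hB⟩ := isCompact_univ.bddAbove_image hc.continuousOn
  have hB' : ∀ z, Real.exp (2 * φ z / h) ≤ B := fun z => hB ⟨z, trivial, rfl⟩
  have hB0 : 0 ≤ B := (Real.exp_nonneg _).trans (hB' 0)
  refine ⟨ENNReal.ofReal B, ENNReal.ofReal_ne_top, ?_⟩
  rw [weightedMeasure, ← withDensity_smul' _ _ ENNReal.ofReal_ne_top]
  conv_lhs => rw [← withDensity_one (μ := (volume : Measure Torus))]
  refine withDensity_mono (Filter.Eventually.of_forall fun z => ?_)
  simp only [Pi.one_apply, Pi.smul_apply, smul_eq_mul]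
  rw [← ENNReal.ofReal_mul hB0, ← ENNReal.ofReal_one]
  refine ENNReal.ofReal_le_ofReal ?_
  calc (1 : ℝ) = Real.exp (2 * φ z / h) * Real.exp (-2 * φ z / h) := by
        rw [← Real.exp_add]; ring_nf; simp
    _ ≤ _ := by gcongr; exact hB' z

theorem memLp_volume {φ : Torus → ℝ} (hφ : Continuous φ) {h : ℝ} (u : L2phi φ h) :
    MemLp u 2 (volume : Measure Torus) := by
  obtain ⟨c, hc, hle⟩ := weight_bounds hφ h
  exact (Lp.memLp u).of_measure_le_smul hc hle

theorem integrable_mul {φ : Torus → ℝ} (hφ : Continuous φ) {h : ℝ} (u : L2phi φ h)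
    {g : Torus → ℂ} (hg : Continuous g) : Integrable (fun z => u z * g z) := by
  have h1 : Integrable (u : Torus → ℂ) (volume : Measure Torus) :=
    (memLp_volume hφ u).integrable (by norm_num)
  obtain ⟨B, hB⟩ := isCompact_univ.bddAbove_image hg.norm.continuousOn
  exact h1.mul_bdd (c := B) hg.aestronglyMeasurable
    (Filter.Eventually.of_forall fun z => hB ⟨z, trivial, rfl⟩)

theorem volume_absolutelyContinuous {φ : Torus → ℝ} (hφ : Continuous φ) (h : ℝ) :
    (volume : Measure Torus) ≪ weightedMeasure φ h := by
  obtain ⟨c, _, hle⟩ := weight_bounds hφ h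
  exact Measure.absolutelyContinuous_of_le_smul hle

/-- The graph of `h ∂̄` on `L²_φ(M)` with its maximal domain
`{u ∈ L²_φ ; h ∂̄ u ∈ L²_φ}`, the derivative being taken in the sense of distributions. -/
def hdbarGraph (φ : Torus → ℝ) (hφ : IsSmooth φ) (h : ℝ) :
    Submodule ℂ (L2phi φ h × L2phi φ h) where
  carrier := {w | HasWeakDbar h w.1 w.2}
  zero_mem' := by
    intro χ _
    have h0 : ((0 : L2phi φ h) : Torus → ℂ) =ᵐ[volume] 0 :=
      (volume_absolutelyContinuous hφ.continuous h).ae_le (Lp.coeFn_zero _ _ _)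
    have e : ∀ g : Torus → ℂ, ∫ z, ((0 : L2phi φ h) : Torus → ℂ) z * g z = 0 := by
      intro g
      rw [integral_eq_zero_of_ae]
      filter_upwards [h0] with z hz
      simp only [hz, Pi.zero_apply, zero_mul]
    simp only [Prod.fst_zero, Prod.snd_zero, e, mul_zero, neg_zero]
  add_mem' := by
    intro a b ha hb χ hχ
    have e : ∀ (u v : L2phi φ h) (g : Torus → ℂ), Continuous g →
        ∫ z, ((u + v : L2phi φ h) : Torus → ℂ) z * g z
          = (∫ z, u z * g z) + ∫ z, v z * g z := by
      intro u v g hg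
      rw [← integral_add (integrable_mul hφ.continuous u hg) (integrable_mul hφ.continuous v hg)]
      refine integral_congr_ae ?_
      filter_upwards [(volume_absolutelyContinuous hφ.continuous h).ae_le (Lp.coeFn_add u v)]
        with z hz
      simp only [hz, Pi.add_apply, add_mul]
    simp only [Prod.fst_add, Prod.snd_add, e _ _ _ hχ.continuous, e _ _ _ (continuous_dbar hχ),
      ha χ hχ, hb χ hχ]
    ring
  smul_mem' := by
    intro c a ha χ hχ
    have e : ∀ (u : L2phi φ h) (g : Torus → ℂ),
        ∫ z, ((c • u : L2phi φ h) : Torus → ℂ) z * g z = c * ∫ z, u z * g z := by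
      intro u g
      rw [← integral_const_mul]
      refine integral_congr_ae ?_
      filter_upwards [(volume_absolutelyContinuous hφ.continuous h).ae_le (Lp.coeFn_smul c u)]
        with z hz
      simp only [hz, Pi.smul_apply, smul_eq_mul, mul_assoc]
    simp only [Prod.smul_fst, Prod.smul_snd, e, ha χ hχ]
    ring

/-- Smooth functions, as a star subalgebra of `C(M, ℂ)`. -/
def smoothAlgebra : StarSubalgebra ℂ C(Torus, ℂ) where
  carrier := {f | IsSmooth f}
  mul_mem' := by
    intro f g (hf : ContDiff ℝ ∞ _) (hg : ContDiff ℝ ∞ _)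
    exact hf.mul hg
  add_mem' := by
    intro f g (hf : ContDiff ℝ ∞ _) (hg : ContDiff ℝ ∞ _)
    exact hf.add hg
  algebraMap_mem' := fun c => show ContDiff ℝ ∞ (fun _ : ℝ × ℝ => c) from contDiff_const
  star_mem' := fun {f} hf =>
    (Complex.conjCLE.contDiff (n := ∞)).comp (show ContDiff ℝ ∞ fun p => f (proj p) from hf)

theorem smoothAlgebra_separatesPoints : smoothAlgebra.SeparatesPoints := by
  have hs : ContDiff ℝ ∞ fun x : ℝ => (fourier 1 (x : AddCircle (2 * Real.pi)) : ℂ) := by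
    simp only [fourier_coe_apply]
    have := Complex.ofRealCLM.contDiff (n := ∞)
    exact (((contDiff_const.mul this).div_const _)).cexp
  have hi : ∀ x y : AddCircle (2 * Real.pi), fourier 1 x = (fourier 1 y : ℂ) → x = y := by
    intro x y hxy
    rw [fourier_one, fourier_one] at hxy
    exact AddCircle.injective_toCircle Real.two_pi_pos.ne' (Subtype.ext hxy)
  intro p q hpq
  by_cases h1 : p.1 = q.1
  · have h2 : p.2 ≠ q.2 := fun h2 => hpq (Prod.ext h1 h2)
    refine ⟨_, ⟨(fourier 1).comp ⟨Prod.snd, continuous_snd⟩, ?_, rfl⟩, fun e => h2 (hi _ _ e)⟩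
    exact hs.comp contDiff_snd
  · refine ⟨_, ⟨(fourier 1).comp ⟨Prod.fst, continuous_fst⟩, ?_, rfl⟩, fun e => h1 (hi _ _ e)⟩
    exact hs.comp contDiff_fst

theorem ae_eq_zero_of_forall_smooth {v : Torus → ℂ} (hv : MemLp v 2 (volume : Measure Torus))
    (h0 : ∀ χ : Torus → ℂ, IsSmooth χ → ∫ z, v z * χ z = 0) : v =ᵐ[volume] 0 := by
  have hzero : ∀ f ∈ smoothAlgebra,
      inner ℂ (ContinuousMap.toLp (E := ℂ) 2 (volume : Measure Torus) ℂ f) (hv.toLp v) = 0 := by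
    intro f hf
    rw [L2.inner_def, ← h0 _ (star_mem hf : star f ∈ smoothAlgebra)]
    refine integral_congr_ae ?_
    filter_upwards [ContinuousMap.coeFn_toLp (p := 2) (𝕜 := ℂ) (volume : Measure Torus) f,
      hv.coeFn_toLp] with z h1 h2
    rw [h1, h2]
    rfl
  have hall : ∀ f : C(Torus, ℂ),
      inner ℂ (ContinuousMap.toLp (E := ℂ) 2 (volume : Measure Torus) ℂ f) (hv.toLp v) = 0 := by
    have hd : Dense (smoothAlgebra : Set C(Torus, ℂ)) := by
      have := ContinuousMap.starSubalgebra_topologicalClosure_eq_top_of_separatesPoints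
        smoothAlgebra smoothAlgebra_separatesPoints
      rw [dense_iff_closure_eq, ← StarSubalgebra.topologicalClosure_coe, this]
      rfl
    intro f
    refine hd.induction (P := fun f => inner ℂ
      (ContinuousMap.toLp (E := ℂ) 2 (volume : Measure Torus) ℂ f) (hv.toLp v) = 0) hzero ?_ f
    exact isClosed_eq (by fun_prop) continuous_const
  have hv0 : hv.toLp v = 0 := by
    refine (ContinuousMap.toLp_denseRange ℂ (volume : Measure Torus) ℂ
      (p := 2) (by norm_num)).eq_zero_of_inner_left ℂ ?_
    exact fun f => inner_eq_zero_symm.1 (hall f)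
  have := hv.coeFn_toLp
  rw [hv0] at this
  exact this.symm.trans (Lp.coeFn_zero _ _ _)

/-- Distributional derivatives are unique, so `hdbarGraph` is the graph of an operator. -/
theorem hdbarGraph_snd_eq_zero (φ : Torus → ℝ) (hφ : IsSmooth φ) (h : ℝ)
    (x : L2phi φ h × L2phi φ h) (hx : x ∈ hdbarGraph φ hφ h) (hx0 : x.1 = 0) : x.2 = 0 := by
  have h0 : (x.1 : Torus → ℂ) =ᵐ[volume] 0 := by
    rw [hx0]
    exact (volume_absolutelyContinuous hφ.continuous h).ae_le (Lp.coeFn_zero _ _ _)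
  have hz : (x.2 : Torus → ℂ) =ᵐ[volume] 0 := by
    refine ae_eq_zero_of_forall_smooth (memLp_volume hφ.continuous x.2) fun χ hχ => ?_
    rw [hx χ hχ, integral_eq_zero_of_ae, mul_zero, neg_zero]
    filter_upwards [h0] with z hz
    simp only [hz, Pi.zero_apply, zero_mul]
  exact Lp.eq_zero_iff_ae_eq_zero.2 ((withDensity_absolutelyContinuous _ _).ae_le hz)

/-- The unbounded operator `h ∂̄ : L²_φ(M) → L²_φ(M)`, with its maximal domain. -/
def hdbar (φ : Torus → ℝ) (hφ : IsSmooth φ) (h : ℝ) : L2phi φ h →ₗ.[ℂ] L2phi φ h :=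
  (hdbarGraph φ hφ h).toLinearPMap

theorem mem_graph_hdbar {φ : Torus → ℝ} {hφ : IsSmooth φ} {h : ℝ} {u v : L2phi φ h} :
    (u, v) ∈ (hdbar φ hφ h).graph ↔ HasWeakDbar h u v := by
  rw [hdbar, Submodule.toLinearPMap_graph_eq _ (hdbarGraph_snd_eq_zero φ hφ h)]
  rfl

section SingularValues

variable {H : Type} [NormedAddCommGroup H] [InnerProductSpace ℂ H] [CompleteSpace H]

/-- The space of `u` in the natural domain `{u ∈ D(T) ; T u ∈ D(T*)}` of `T* T` such that
`T* T u = t² u`; its nonzero elements are the singular states associated to `t`. -/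
def singularSpace (T : H →ₗ.[ℂ] H) (t : ℝ) : Submodule ℂ H where
  carrier := {u | ∃ v, (u, v) ∈ T.graph ∧ (v, ((t : ℂ) ^ 2) • u) ∈ T.adjoint.graph}
  zero_mem' := ⟨0, T.graph.zero_mem, by simp⟩
  add_mem' := by
    rintro a b ⟨v, h1, h2⟩ ⟨w, h3, h4⟩
    exact ⟨v + w, T.graph.add_mem h1 h3, by simpa using T.adjoint.graph.add_mem h2 h4⟩
  smul_mem' := by
    rintro c a ⟨v, h1, h2⟩
    refine ⟨c • v, T.graph.smul_mem c h1, ?_⟩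
    have := T.adjoint.graph.smul_mem c h2
    rwa [Prod.smul_mk, smul_comm] at this

/-- `t ≥ 0` is a singular value of `T` if `t²` is an eigenvalue of `T* T`. -/
def IsSingularValue (T : H →ₗ.[ℂ] H) (t : ℝ) : Prop :=
  0 ≤ t ∧ singularSpace T t ≠ ⊥

end SingularValues

end DbarTorus

end

/-! Everything rests on a Poincaré inequality. The characters `e^{i(kx + ly)}` diagonalise `h ∂̄`
with multipliers `h (i/2)(k + il)`, of modulus at least `h/2` unless `k = l = 0`. By Parseval,
subtracting its mean from `u` leaves a function of norm at most `(2/h) ‖h ∂̄ u‖` in unweighted `L²`.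
Comparing the weight with its extreme values costs a factor `e^{(max φ - min φ)/h}` in `L²_φ`
(`exists_norm_sub_smul_oneL2_le`). In particular the kernel consists of the constants, and it is
also the kernel of `T* T` for `T = h ∂̄`.

If `t > 0` and `T* T u = t² u`, then `u` is orthogonal in `L²_φ` to the constants and `‖T u‖ = t
‖u‖`. Orthogonality makes the distance from `u` to the constants equal to `‖u‖`, so a nonzero `u`
forces `1 ≤ (2/h) e^{(max φ - min φ)/h} t`. For `t ≤ e^{-τ/h}` this fails once `h` is small. No
spectral theory is needed: only the graphs of `T` and `T*`, and the density of the domain. -/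

namespace DbarTorus

/-! ### Fourier analysis on the torus -/

/-- The characters `e^{i(kx + ly)}` of the torus, indexed by `n = (k, l)`. -/
noncomputable def character (n : ℤ × ℤ) : C(Torus, ℂ) :=
  (fourier n.1).comp ⟨Prod.fst, continuous_fst⟩ * (fourier n.2).comp ⟨Prod.snd, continuous_snd⟩

theorem character_apply (n : ℤ × ℤ) (z : Torus) :
    character n z = fourier n.1 z.1 * fourier n.2 z.2 := rfl

theorem character_zero : character 0 = 1 := by
  ext z
  simp [character_apply]

theorem character_add (m n : ℤ × ℤ) : character (m + n) = character m * character n := by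
  ext z
  simp only [character_apply, ContinuousMap.mul_apply, Prod.fst_add, Prod.snd_add, fourier_add]
  ring

theorem character_neg (n : ℤ × ℤ) : character (-n) = star (character n) := by
  ext z
  simp only [character_apply, Prod.fst_neg, Prod.snd_neg, fourier_neg]
  exact (map_mul (starRingEnd ℂ) _ _).symm

theorem contDiff_fourier_coe (k : ℤ) :
    ContDiff ℝ ∞ fun x : ℝ => (fourier k (x : AddCircle (2 * Real.pi)) : ℂ) := by
  simp only [fourier_coe_apply]
  exact ((contDiff_const.mul (Complex.ofRealCLM.contDiff (n := ∞))).div_const _).cexp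

theorem isSmooth_character (n : ℤ × ℤ) : IsSmooth (character n) :=
  ((contDiff_fourier_coe n.1).comp contDiff_fst).mul ((contDiff_fourier_coe n.2).comp contDiff_snd)

theorem isSmooth_const (c : ℂ) : IsSmooth fun _ => c := contDiff_const

theorem hasDerivAt_fourier_translate (k : ℤ) (x : AddCircle (2 * Real.pi)) :
    HasDerivAt (fun t : ℝ => (fourier k (x + (t : AddCircle (2 * Real.pi))) : ℂ))
      (Complex.I * k * fourier k x) 0 := by
  induction x using QuotientAddGroup.induction_on with
  | H a =>
    have h1 := (hasDerivAt_fourier (2 * Real.pi) k (a + 0)).comp_const_add a 0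
    have e : 2 * (Real.pi : ℂ) * Complex.I * k / ((2 * Real.pi : ℝ) : ℂ) = Complex.I * k := by
      have : (Real.pi : ℂ) ≠ 0 := Complex.ofReal_ne_zero.2 Real.pi_ne_zero
      push_cast
      field_simp
    rw [e, add_zero] at h1
    simpa only [AddCircle.coe_add] using h1

theorem dbar_character (n : ℤ × ℤ) (z : Torus) :
    dbar (character n) z = Complex.I / 2 * (n.1 + Complex.I * n.2) * character n z := by
  have h1 := ((hasDerivAt_fourier_translate n.1 z.1).mul_const (fourier n.2 z.2 : ℂ)).deriv
  have h2 := ((hasDerivAt_fourier_translate n.2 z.2).const_mul (fourier n.1 z.1 : ℂ)).deriv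
  simp only [dbar, character_apply, h1, h2]
  ring

/-- The Haar probability measure on the torus. -/
noncomputable def haarTorus : Measure Torus :=
  AddCircle.haarAddCircle.prod AddCircle.haarAddCircle

instance isProbabilityMeasure_haarTorus : IsProbabilityMeasure haarTorus := by
  unfold haarTorus; infer_instance

theorem volume_eq_smul_haarTorus : (volume : Measure Torus) =
    (ENNReal.ofReal (2 * Real.pi) * ENNReal.ofReal (2 * Real.pi)) • haarTorus := by
  rw [haarTorus, Measure.volume_eq_prod, AddCircle.volume_eq_smul_haarAddCircle,
    Measure.prod_smul_left, Measure.prod_smul_right, smul_smul]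

theorem integral_fourier_haar (k : ℤ) :
    ∫ x : AddCircle (2 * Real.pi), (fourier k x : ℂ) ∂AddCircle.haarAddCircle
      = if k = 0 then 1 else 0 := by
  have h := orthonormal_iff_ite.1 (orthonormal_fourier (T := 2 * Real.pi)) 0 k
  simpa [ContinuousMap.inner_toLp, eq_comm] using h

theorem integral_character (n : ℤ × ℤ) :
    ∫ z, character n z ∂haarTorus = if n = 0 then 1 else 0 := by
  simp only [character_apply]
  rw [haarTorus, integral_prod_mul (fun x => (fourier n.1 x : ℂ)) (fun y => (fourier n.2 y : ℂ)),
    integral_fourier_haar, integral_fourier_haar]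
  rcases n with ⟨k, l⟩
  by_cases hk : k = 0 <;> by_cases hl : l = 0 <;> simp [hk, hl]

/-- The characters as elements of `L²`. -/
noncomputable abbrev characterL2 (n : ℤ × ℤ) : Lp ℂ 2 haarTorus :=
  ContinuousMap.toLp (E := ℂ) 2 haarTorus ℂ (character n)

theorem orthonormal_character : Orthonormal ℂ characterL2 := by
  rw [orthonormal_iff_ite]
  intro m n
  have h : ∀ z, (character n z) * starRingEnd ℂ (character m z) = character (n + -m) z := by
    intro z
    rw [character_add, character_neg]
    rfl
  simp only [characterL2, ContinuousMap.inner_toLp, h, integral_character]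
  simp [← sub_eq_add_neg, sub_eq_zero, eq_comm]

/-- The star subalgebra of `C(M, ℂ)` generated by the characters. -/
noncomputable def characterSubalgebra : StarSubalgebra ℂ C(Torus, ℂ) where
  toSubalgebra := Algebra.adjoin ℂ (Set.range character)
  star_mem' := by
    change Algebra.adjoin ℂ (Set.range character) ≤ star (Algebra.adjoin ℂ (Set.range character))
    refine Algebra.adjoin_le ?_
    rintro _ ⟨n, rfl⟩
    exact Algebra.subset_adjoin ⟨-n, character_neg n⟩

/-- The characters are closed under products and contain `1`, so generating an algebra adds nothing
to their linear span. -/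
theorem characterSubalgebra_toSubmodule :
    characterSubalgebra.toSubalgebra.toSubmodule = Submodule.span ℂ (Set.range character) := by
  apply Algebra.adjoin_eq_span_of_subset
  refine .trans (fun x ↦ Submonoid.closure_induction (fun _ ↦ id) ⟨0, character_zero⟩ ?_)
    Submodule.subset_span
  rintro _ _ _ _ ⟨m, rfl⟩ ⟨n, rfl⟩
  exact ⟨m + n, character_add m n⟩

theorem characterSubalgebra_separatesPoints : characterSubalgebra.SeparatesPoints := by
  have hi : ∀ x y : AddCircle (2 * Real.pi), fourier 1 x = (fourier 1 y : ℂ) → x = y := by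
    intro x y hxy
    rw [fourier_one, fourier_one] at hxy
    exact AddCircle.injective_toCircle Real.two_pi_pos.ne' (Subtype.ext hxy)
  intro p q hpq
  by_cases h1 : p.1 = q.1
  · refine ⟨_, ⟨character (0, 1), Algebra.subset_adjoin ⟨_, rfl⟩, rfl⟩, fun e => ?_⟩
    simp only [character_apply, fourier_zero, one_mul] at e
    exact hpq (Prod.ext h1 (hi _ _ e))
  · refine ⟨_, ⟨character (1, 0), Algebra.subset_adjoin ⟨_, rfl⟩, rfl⟩, fun e => ?_⟩
    simp only [character_apply, fourier_zero, mul_one] at e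
    exact h1 (hi _ _ e)

theorem span_character_closure_eq_top :
    (Submodule.span ℂ (Set.range character)).topologicalClosure = ⊤ := by
  rw [← characterSubalgebra_toSubmodule]
  exact congr_arg (Subalgebra.toSubmodule <| StarSubalgebra.toSubalgebra ·)
    (ContinuousMap.starSubalgebra_topologicalClosure_eq_top_of_separatesPoints _
      characterSubalgebra_separatesPoints)

/-- The measure is left general because two are needed: Haar measure for the Hilbert basis, and the
weighted measure for the density of the domain of `h ∂̄`. -/
theorem span_toLp_character_closure_eq_top (μ : Measure Torus) [IsFiniteMeasure μ] :
    (Submodule.span ℂ (Set.range fun n =>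
      ContinuousMap.toLp (E := ℂ) 2 μ ℂ (character n))).topologicalClosure = ⊤ := by
  simpa only [Submodule.map_span, ContinuousLinearMap.coe_coe, ← Set.range_comp,
    Function.comp_def] using
    (ContinuousMap.toLp_denseRange ℂ μ ℂ (p := 2)
      (by norm_num)).topologicalClosure_map_submodule span_character_closure_eq_top

/-- The characters form a Hilbert basis of `L²(M)`. -/
noncomputable def characterBasis : HilbertBasis (ℤ × ℤ) ℂ (Lp ℂ 2 haarTorus) :=
  HilbertBasis.mk orthonormal_character (span_toLp_character_closure_eq_top haarTorus).ge

/-- Writing the conjugate as `character (-n)` turns Fourier coefficients into the bilinear pairings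
of `HasWeakDbar`. -/
theorem inner_characterBasis {f : Torus → ℂ} (hf : MemLp f 2 haarTorus) (n : ℤ × ℤ) :
    inner ℂ (characterBasis n) (hf.toLp f) = ∫ z, f z * character (-n) z ∂haarTorus := by
  rw [characterBasis, HilbertBasis.coe_mk, L2.inner_def]
  refine integral_congr_ae ?_
  filter_upwards [ContinuousMap.coeFn_toLp (p := 2) (𝕜 := ℂ) haarTorus (character n),
    hf.coeFn_toLp] with z h1 h2
  rw [h1, h2, character_neg]
  rfl

end DbarTorus

/-! ### Parseval and coefficientwise comparison of norms -/

theorem HilbertBasis.hasSum_norm_sq_inner {ι H : Type*} [NormedAddCommGroup H]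
    [InnerProductSpace ℂ H] (b : HilbertBasis ι ℂ H) (x : H) :
    HasSum (fun i => ‖inner ℂ (b i) x‖ ^ 2) (‖x‖ ^ 2) := by
  have h := Complex.hasSum_re (b.hasSum_inner_mul_inner x x)
  rw [← inner_self_eq_norm_sq (𝕜 := ℂ)]
  refine h.congr_fun fun i => ?_
  rw [← inner_conj_symm x (b i), ← Complex.normSq_eq_conj_mul_self, Complex.ofReal_re,
    Complex.normSq_eq_norm_sq]

theorem HilbertBasis.norm_le_of_forall_inner_le {ι H : Type*} [NormedAddCommGroup H]
    [InnerProductSpace ℂ H] (b : HilbertBasis ι ℂ H) {x y : H} {C : ℝ} (hC : 0 ≤ C)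
    (hxy : ∀ i, ‖inner ℂ (b i) x‖ ≤ C * ‖inner ℂ (b i) y‖) : ‖x‖ ≤ C * ‖y‖ := by
  refine le_of_sq_le_sq ?_ (by positivity)
  rw [mul_pow]
  refine hasSum_le (fun i => ?_) (b.hasSum_norm_sq_inner x)
    ((b.hasSum_norm_sq_inner y).mul_left (C ^ 2))
  rw [← mul_pow]
  exact pow_le_pow_left₀ (norm_nonneg _) (hxy i) 2

namespace DbarTorus

/-! ### Integration by parts for smooth functions -/

theorem proj_surjective : Function.Surjective proj := isOpenQuotientMap_proj.surjective

theorem IsSmooth.hasDerivAt_translate {f : Torus → ℂ} (hf : IsSmooth f) (p w : ℝ × ℝ) :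
    HasDerivAt (fun t : ℝ => f (proj (p + t • w))) (fderiv ℝ (fun q => f (proj q)) p w) 0 := by
  have hd : DifferentiableAt ℝ (fun q => f (proj q)) p :=
    (ContDiff.differentiable hf (by simp)).differentiableAt
  have h1 : HasDerivAt (fun t : ℝ => p + t • w) w 0 := by
    simpa using ((hasDerivAt_id (0 : ℝ)).smul_const w).const_add p
  have h2 : HasFDerivAt (fun q => f (proj q)) (fderiv ℝ (fun q => f (proj q)) p)
      (p + (0 : ℝ) • w) := by simpa using hd.hasFDerivAt
  exact h2.comp_hasDerivAt (0 : ℝ) h1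

theorem IsSmooth.hasDerivAt_fst {f : Torus → ℂ} (hf : IsSmooth f) (p : ℝ × ℝ) :
    HasDerivAt (fun t : ℝ => f ((proj p).1 + (t : AddCircle (2 * Real.pi)), (proj p).2))
      (fderiv ℝ (fun q => f (proj q)) p (1, 0)) 0 := by
  simpa only [proj, Prod.smul_mk, smul_eq_mul, mul_one, mul_zero, Prod.fst_add, Prod.snd_add,
    add_zero, AddCircle.coe_add] using hf.hasDerivAt_translate p (1, 0)

theorem IsSmooth.hasDerivAt_snd {f : Torus → ℂ} (hf : IsSmooth f) (p : ℝ × ℝ) :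
    HasDerivAt (fun t : ℝ => f ((proj p).1, (proj p).2 + (t : AddCircle (2 * Real.pi))))
      (fderiv ℝ (fun q => f (proj q)) p (0, 1)) 0 := by
  simpa only [proj, Prod.smul_mk, smul_eq_mul, mul_one, mul_zero, Prod.fst_add, Prod.snd_add,
    add_zero, AddCircle.coe_add] using hf.hasDerivAt_translate p (0, 1)

theorem IsSmooth.mul {f g : Torus → ℂ} (hf : IsSmooth f) (hg : IsSmooth g) :
    IsSmooth fun z => f z * g z := ContDiff.mul hf hg

theorem dbar_mul {f g : Torus → ℂ} (hf : IsSmooth f) (hg : IsSmooth g) (z : Torus) :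
    dbar (fun z => f z * g z) z = dbar f z * g z + f z * dbar g z := by
  obtain ⟨p, rfl⟩ := proj_surjective z
  have hx := ((hf.hasDerivAt_fst p).mul (hg.hasDerivAt_fst p)).deriv
  have hy := ((hf.hasDerivAt_snd p).mul (hg.hasDerivAt_snd p)).deriv
  simp only [Pi.mul_def, AddCircle.coe_zero, add_zero, Prod.mk.eta] at hx hy
  rw [dbar_proj hf, dbar_proj hg, dbar, hx, hy]
  ring

theorem IsSmooth.continuous_deriv_fst {f : Torus → ℂ} (hf : IsSmooth f) :
    Continuous fun z : Torus =>
      deriv (fun t : ℝ => f (z.1 + (t : AddCircle (2 * Real.pi)), z.2)) 0 := by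
  refine isOpenQuotientMap_proj.continuous_comp_iff.1 ?_
  have h1 : Continuous (fderiv ℝ (fun q => f (proj q))) :=
    ContDiff.continuous_fderiv hf (by simp)
  exact (h1.clm_apply continuous_const).congr fun p => (hf.hasDerivAt_fst p).deriv.symm

theorem IsSmooth.continuous_deriv_snd {f : Torus → ℂ} (hf : IsSmooth f) :
    Continuous fun z : Torus =>
      deriv (fun t : ℝ => f (z.1, z.2 + (t : AddCircle (2 * Real.pi)))) 0 := by
  refine isOpenQuotientMap_proj.continuous_comp_iff.1 ?_
  have h1 : Continuous (fderiv ℝ (fun q => f (proj q))) :=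
    ContDiff.continuous_fderiv hf (by simp)
  exact (h1.clm_apply continuous_const).congr fun p => (hf.hasDerivAt_snd p).deriv.symm

theorem integral_deriv_translate {g : AddCircle (2 * Real.pi) → ℂ}
    (hg : ContDiff ℝ ∞ fun x : ℝ => g x) :
    ∫ x, deriv (fun t : ℝ => g (x + (t : AddCircle (2 * Real.pi)))) 0 = 0 := by
  have e : ∀ x : ℝ, deriv (fun t : ℝ => g (x + (t : AddCircle (2 * Real.pi)))) 0
      = deriv (fun x : ℝ => g x) x := by
    intro x
    simp only [← AddCircle.coe_add]
    rw [deriv_comp_const_add (fun x : ℝ => g x) x 0, add_zero]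
  rw [← AddCircle.intervalIntegral_preimage (2 * Real.pi) 0]
  simp only [e]
  rw [intervalIntegral.integral_deriv_eq_sub
    (fun x _ => (hg.differentiable (by simp)).differentiableAt)
    ((hg.continuous_deriv (by simp)).intervalIntegrable _ _)]
  simp only [zero_add, AddCircle.coe_period, AddCircle.coe_zero, sub_self]

theorem integral_deriv_fst {f : Torus → ℂ} (hf : IsSmooth f) :
    ∫ z : Torus, deriv (fun t : ℝ => f (z.1 + (t : AddCircle (2 * Real.pi)), z.2)) 0 = 0 := by
  have hc := hf.continuous_deriv_fst.integrable_of_hasCompactSupport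
    (μ := (volume : Measure Torus)) (HasCompactSupport.of_compactSpace _)
  rw [Measure.volume_eq_prod, integral_prod_symm _ hc]
  refine integral_eq_zero_of_ae (.of_forall fun y => ?_)
  -- Smoothness is known only for the lift to `ℝ²`, so the frozen variable is lifted to a real
  -- number.
  obtain ⟨b, rfl⟩ := QuotientAddGroup.mk_surjective y
  exact integral_deriv_translate (g := fun x => f (x, (b : AddCircle (2 * Real.pi))))
    (ContDiff.comp (g := fun p : ℝ × ℝ => f (proj p)) hf (contDiff_id.prodMk contDiff_const))

theorem integral_deriv_snd {f : Torus → ℂ} (hf : IsSmooth f) :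
    ∫ z : Torus, deriv (fun t : ℝ => f (z.1, z.2 + (t : AddCircle (2 * Real.pi)))) 0 = 0 := by
  have hc := hf.continuous_deriv_snd.integrable_of_hasCompactSupport
    (μ := (volume : Measure Torus)) (HasCompactSupport.of_compactSpace _)
  rw [Measure.volume_eq_prod, integral_prod _ hc]
  refine integral_eq_zero_of_ae (.of_forall fun x => ?_)
  obtain ⟨a, rfl⟩ := QuotientAddGroup.mk_surjective x
  exact integral_deriv_translate (g := fun y => f ((a : AddCircle (2 * Real.pi)), y))
    (ContDiff.comp (g := fun p : ℝ × ℝ => f (proj p)) hf (contDiff_const.prodMk contDiff_id))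

theorem integrable_of_continuous {f : Torus → ℂ} (hf : Continuous f) :
    Integrable f (volume : Measure Torus) :=
  hf.integrable_of_hasCompactSupport (HasCompactSupport.of_compactSpace _)

theorem integral_dbar {f : Torus → ℂ} (hf : IsSmooth f) : ∫ z, dbar f z = 0 := by
  simp only [dbar]
  rw [integral_const_mul, integral_add (integrable_of_continuous hf.continuous_deriv_fst)
    ((integrable_of_continuous hf.continuous_deriv_snd).const_mul _), integral_const_mul,
    integral_deriv_fst hf, integral_deriv_snd hf]
  simp

/-- The Leibniz rule applied to `f χ`, whose `∂̄` has integral zero because the torus has no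
boundary. This puts the characters in the domain and the constants in the kernel. -/
theorem hasWeakDbar_of_isSmooth (h : ℝ) {f : Torus → ℂ} (hf : IsSmooth f) :
    HasWeakDbar h f fun z => h * dbar f z := by
  intro χ hχ
  have h0 := integral_dbar (hf.mul hχ)
  have i1 : Integrable (fun z => dbar f z * χ z) (volume : Measure Torus) :=
    integrable_of_continuous ((continuous_dbar hf).mul hχ.continuous)
  have i2 : Integrable (fun z => f z * dbar χ z) (volume : Measure Torus) :=
    integrable_of_continuous (hf.continuous.mul (continuous_dbar hχ))
  simp only [dbar_mul hf hχ] at h0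
  rw [integral_add i1 i2] at h0
  simp only [mul_assoc]
  rw [integral_const_mul, eq_neg_of_add_eq_zero_left h0, mul_neg]

theorem HasWeakDbar.congr_ae {h : ℝ} {u v u' v' : Torus → ℂ} (huv : HasWeakDbar h u v)
    (hu : u' =ᵐ[volume] u) (hv : v' =ᵐ[volume] v) : HasWeakDbar h u' v' := by
  intro χ hχ
  have e1 : ∫ z, v' z * χ z = ∫ z, v z * χ z :=
    integral_congr_ae (hv.mono fun z hz => by simp only [hz])
  have e2 : ∫ z, u' z * dbar χ z = ∫ z, u z * dbar χ z :=
    integral_congr_ae (hu.mono fun z hz => by simp only [hz])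
  rw [e1, e2, huv χ hχ]

/-! ### The Poincaré inequality in unweighted `L²` -/

theorem HasWeakDbar.integral_character {h : ℝ} {u v : Torus → ℂ} (huv : HasWeakDbar h u v)
    (n : ℤ × ℤ) : ∫ z, v z * character (-n) z ∂haarTorus
      = h * (Complex.I / 2 * (n.1 + Complex.I * n.2)) *
        ∫ z, u z * character (-n) z ∂haarTorus := by
  have h1 := huv _ (isSmooth_character (-n))
  -- Differentiating `character (-n)` gives a minus sign, which cancels the one in `HasWeakDbar`.
  have e : ∀ z, u z * dbar (character (-n)) z
      = -(Complex.I / 2 * (n.1 + Complex.I * n.2)) * (u z * character (-n) z) := by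
    intro z
    rw [dbar_character]
    push_cast [Prod.fst_neg, Prod.snd_neg]
    ring
  simp only [e, integral_const_mul] at h1
  rw [volume_eq_smul_haarTorus] at h1
  simp only [integral_smul_measure, ← ENNReal.ofReal_mul Real.two_pi_pos.le] at h1
  rw [ENNReal.toReal_ofReal (by positivity), Complex.real_smul, Complex.real_smul] at h1
  have hpi : ((2 * Real.pi * (2 * Real.pi) : ℝ) : ℂ) ≠ 0 :=
    Complex.ofReal_ne_zero.2 (by positivity)
  refine mul_left_cancel₀ hpi (h1.trans ?_)
  ring

/-- The squared modulus is a positive integer. This is the spectral gap behind the constant `2 / h`.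
-/
theorem one_le_norm_intCast_add {n : ℤ × ℤ} (hn : n ≠ 0) :
    1 ≤ ‖((n.1 : ℂ) + Complex.I * n.2)‖ := by
  have h1 : ‖((n.1 : ℂ) + Complex.I * n.2)‖ ^ 2 = ((n.1 ^ 2 + n.2 ^ 2 : ℤ) : ℝ) := by
    rw [← Complex.normSq_eq_norm_sq, Complex.normSq_apply]
    simp
    ring
  have h2 : 1 ≤ n.1 ^ 2 + n.2 ^ 2 := by
    by_contra hlt
    have h3 : n.1 ^ 2 = 0 := by nlinarith [sq_nonneg n.1, sq_nonneg n.2]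
    have h4 : n.2 ^ 2 = 0 := by nlinarith [sq_nonneg n.1, sq_nonneg n.2]
    exact hn (Prod.ext (by simpa using h3) (by simpa using h4))
  have h5 : (1 : ℝ) ≤ ‖((n.1 : ℂ) + Complex.I * n.2)‖ ^ 2 := by
    rw [h1]; exact_mod_cast h2
  nlinarith [norm_nonneg ((n.1 : ℂ) + Complex.I * n.2)]

/-- Poincaré inequality for `h ∂̄`, with respect to the Haar probability measure. -/
theorem HasWeakDbar.eLpNorm_sub_const_le_haarTorus {h : ℝ} (hh : 0 < h) {u v : Torus → ℂ}
    (hu : MemLp u 2 haarTorus) (hv : MemLp v 2 haarTorus) (huv : HasWeakDbar h u v) :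
    eLpNorm (fun z => u z - ∫ w, u w ∂haarTorus) 2 haarTorus
      ≤ ENNReal.ofReal (2 / h) * eLpNorm v 2 haarTorus := by
  set c := ∫ w, u w ∂haarTorus with hc
  have hw : MemLp (fun z => u z - c) 2 haarTorus := hu.sub (memLp_const c)
  have key : ‖hw.toLp _‖ ≤ 2 / h * ‖hv.toLp v‖ := by
    refine characterBasis.norm_le_of_forall_inner_le (by positivity) fun n => ?_
    rw [inner_characterBasis, inner_characterBasis]
    have hui : Integrable u haarTorus := hu.integrable (by norm_num)
    have hci : Integrable (fun z => character (-n) z) haarTorus :=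
      (character (-n)).continuous.integrable_of_hasCompactSupport
        (HasCompactSupport.of_compactSpace _)
    have huc : Integrable (fun z => u z * character (-n) z) haarTorus :=
      hui.mul_bdd (c := ‖character (-n)‖) hci.aestronglyMeasurable
        (.of_forall fun z => (character (-n)).norm_coe_le_norm z)
    have hsub : ∫ z, (u z - c) * character (-n) z ∂haarTorus
        = (∫ z, u z * character (-n) z ∂haarTorus) - c * if n = 0 then 1 else 0 := by
      simp only [sub_mul]
      rw [integral_sub huc (hci.const_mul c), integral_const_mul, DbarTorus.integral_character]
      simp
    rw [hsub]
    -- Removing the mean kills the zero mode; every other mode of `u` is that of `v` divided by a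
    -- multiplier of modulus at least `h / 2`.
    by_cases hn : n = 0
    · subst hn
      simp only [neg_zero, character_zero, ContinuousMap.one_apply, mul_one, if_true, ← hc,
        sub_self, norm_zero]
      positivity
    · rw [if_neg hn, mul_zero, sub_zero, huv.integral_character n]
      simp only [norm_mul, norm_div, Complex.norm_I, Complex.norm_real, Real.norm_eq_abs,
        abs_of_pos hh, Complex.norm_ofNat]
      have h1 := one_le_norm_intCast_add hn
      calc _ ≤ ‖((n.1 : ℂ) + Complex.I * n.2)‖ * ‖∫ z, u z * character (-n) z ∂haarTorus‖ :=
            le_mul_of_one_le_left (norm_nonneg _) h1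
        _ = _ := by field_simp
  rw [Lp.norm_toLp, Lp.norm_toLp] at key
  rw [← ENNReal.toReal_le_toReal hw.2.ne (ENNReal.mul_ne_top ENNReal.ofReal_ne_top hv.2.ne),
    ENNReal.toReal_mul, ENNReal.toReal_ofReal (by positivity)]
  exact key

/-- Poincaré inequality for `h ∂̄`. -/
theorem HasWeakDbar.exists_eLpNorm_sub_const_le {h : ℝ} (hh : 0 < h) {u v : Torus → ℂ}
    (hu : MemLp u 2 (volume : Measure Torus)) (hv : MemLp v 2 (volume : Measure Torus))
    (huv : HasWeakDbar h u v) :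
    ∃ c : ℂ, eLpNorm (fun z => u z - c) 2 (volume : Measure Torus)
      ≤ ENNReal.ofReal (2 / h) * eLpNorm v 2 (volume : Measure Torus) := by
  set K := ENNReal.ofReal (2 * Real.pi) * ENNReal.ofReal (2 * Real.pi) with hK
  have hK0 : K ≠ 0 := by
    rw [hK, ← ENNReal.ofReal_mul Real.two_pi_pos.le]
    exact (ENNReal.ofReal_pos.2 (by positivity)).ne'
  have hKt : K ≠ ⊤ := ENNReal.mul_ne_top ENNReal.ofReal_ne_top ENNReal.ofReal_ne_top
  have hle : haarTorus ≤ K⁻¹ • (volume : Measure Torus) := by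
    rw [volume_eq_smul_haarTorus, smul_smul, ENNReal.inv_mul_cancel hK0 hKt, one_smul]
  have hKi : K⁻¹ ≠ ⊤ := ENNReal.inv_ne_top.2 hK0
  refine ⟨∫ w, u w ∂haarTorus, ?_⟩
  -- Both norms acquire the same power of the total mass `K`, so the constant `2 / h` is unchanged.
  rw [volume_eq_smul_haarTorus, eLpNorm_smul_measure_of_ne_top (by norm_num),
    eLpNorm_smul_measure_of_ne_top (by norm_num), smul_eq_mul, smul_eq_mul, mul_left_comm]
  gcongr
  exact huv.eLpNorm_sub_const_le_haarTorus hh (hu.of_measure_le_smul hKi hle)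
    (hv.of_measure_le_smul hKi hle)

/-! ### Passage to the weighted space -/

theorem weightedMeasure_le_smul_volume {φ : Torus → ℝ} {h m : ℝ} (hh : 0 < h)
    (hm : ∀ z, m ≤ φ z) :
    weightedMeasure φ h ≤ ENNReal.ofReal (Real.exp (-2 * m / h)) • (volume : Measure Torus) := by
  rw [weightedMeasure, ← withDensity_const]
  refine withDensity_mono (.of_forall fun z => ENNReal.ofReal_le_ofReal (Real.exp_le_exp.2 ?_))
  exact div_le_div_of_nonneg_right (by linarith [hm z]) hh.le

/-- Unlike `weight_bounds`, this keeps the constant explicit: the exponential rate decides which `τ`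
are allowed. -/
theorem volume_le_smul_weightedMeasure {φ : Torus → ℝ} {h M : ℝ} (hh : 0 < h)
    (hM : ∀ z, φ z ≤ M) :
    (volume : Measure Torus) ≤ ENNReal.ofReal (Real.exp (2 * M / h)) • weightedMeasure φ h := by
  rw [weightedMeasure, ← withDensity_smul' _ _ ENNReal.ofReal_ne_top]
  conv_lhs => rw [← withDensity_one (μ := (volume : Measure Torus))]
  refine withDensity_mono (.of_forall fun z => ?_)
  simp only [Pi.one_apply, Pi.smul_apply, smul_eq_mul]
  rw [← ENNReal.ofReal_mul (Real.exp_nonneg _), ← Real.exp_add, ← ENNReal.ofReal_one]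
  refine ENNReal.ofReal_le_ofReal (Real.one_le_exp ?_)
  rw [← add_div]
  exact div_nonneg (by linarith [hM z]) hh.le

theorem isFiniteMeasure_weightedMeasure {φ : Torus → ℝ} (hφ : Continuous φ) (h : ℝ) :
    IsFiniteMeasure (weightedMeasure φ h) := by
  have hc : Continuous fun z => Real.exp (-2 * φ z / h) := by fun_prop
  have hi : Integrable (fun z => Real.exp (-2 * φ z / h)) (volume : Measure Torus) :=
    hc.integrable_of_hasCompactSupport (HasCompactSupport.of_compactSpace _)
  exact isFiniteMeasure_withDensity_ofReal hi.2

theorem memLp_weightedMeasure {φ : Torus → ℝ} (hφ : Continuous φ) (h : ℝ) {f : Torus → ℂ}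
    (hf : Continuous f) : MemLp f 2 (weightedMeasure φ h) := by
  have := isFiniteMeasure_weightedMeasure hφ h
  exact MemLp.of_bound hf.aestronglyMeasurable ‖(⟨f, hf⟩ : C(Torus, ℂ))‖
    (.of_forall fun z => ContinuousMap.norm_coe_le_norm ⟨f, hf⟩ z)

theorem mem_graph_hdbar_of_isSmooth {φ : Torus → ℝ} (hφ : IsSmooth φ) (h : ℝ) {f : Torus → ℂ}
    (hf : IsSmooth f) :
    ((memLp_weightedMeasure hφ.continuous h hf.continuous).toLp f,
      (memLp_weightedMeasure hφ.continuous h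
        (continuous_const.mul (continuous_dbar hf))).toLp fun z => (h : ℂ) * dbar f z)
      ∈ (hdbar φ hφ h).graph :=
  mem_graph_hdbar.2 <| (hasWeakDbar_of_isSmooth h hf).congr_ae
    ((volume_absolutelyContinuous hφ.continuous h).ae_le (MemLp.coeFn_toLp _))
    ((volume_absolutelyContinuous hφ.continuous h).ae_le (MemLp.coeFn_toLp _))

theorem dense_domain_hdbar {φ : Torus → ℝ} (hφ : IsSmooth φ) (h : ℝ) :
    Dense ((hdbar φ hφ h).domain : Set (L2phi φ h)) := by
  have := isFiniteMeasure_weightedMeasure hφ.continuous h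
  rw [Submodule.dense_iff_topologicalClosure_eq_top, eq_top_iff,
    ← span_toLp_character_closure_eq_top (weightedMeasure φ h)]
  refine Submodule.topologicalClosure_mono (Submodule.span_le.2 ?_)
  rintro _ ⟨n, rfl⟩
  exact LinearPMap.mem_domain_of_mem_graph
    (mem_graph_hdbar_of_isSmooth hφ h (isSmooth_character n))

/-- The constant function `1` as an element of `L²_φ(M)`. -/
noncomputable def oneL2 {φ : Torus → ℝ} (hφ : IsSmooth φ) (h : ℝ) : L2phi φ h :=
  (memLp_weightedMeasure hφ.continuous h (isSmooth_const 1).continuous).toLp fun _ => (1 : ℂ)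

theorem oneL2_mem_graph {φ : Torus → ℝ} (hφ : IsSmooth φ) (h : ℝ) :
    (oneL2 hφ h, 0) ∈ (hdbar φ hφ h).graph := by
  have hac := (volume_absolutelyContinuous hφ.continuous h).ae_le
  refine mem_graph_hdbar.2 <| (hasWeakDbar_of_isSmooth h (isSmooth_const 1)).congr_ae
    (hac (MemLp.coeFn_toLp _)) ?_
  filter_upwards [hac (Lp.coeFn_zero ℂ 2 (weightedMeasure φ h))] with z hz
  exact hz.trans (by simp [dbar])

theorem oneL2_ne_zero {φ : Torus → ℝ} (hφ : IsSmooth φ) (h : ℝ) : oneL2 hφ h ≠ 0 := by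
  intro h0
  have h1 := MemLp.coeFn_toLp
    (memLp_weightedMeasure hφ.continuous h (isSmooth_const 1).continuous)
  change (oneL2 hφ h : Torus → ℂ) =ᵐ[_] _ at h1
  rw [h0] at h1
  have h2 : ∀ᵐ _ : Torus, (1 : ℂ) = 0 := (volume_absolutelyContinuous hφ.continuous h).ae_le
    (h1.symm.trans (Lp.coeFn_zero _ _ _))
  obtain ⟨-, hz⟩ := h2.exists
  exact one_ne_zero hz

/-- Poincaré inequality for `h ∂̄` in the weighted space. -/
theorem exists_norm_sub_smul_oneL2_le {φ : Torus → ℝ} (hφ : IsSmooth φ) {h m M : ℝ} (hh : 0 < h)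
    (hm : ∀ z, m ≤ φ z) (hM : ∀ z, φ z ≤ M) {u v : L2phi φ h}
    (huv : (u, v) ∈ (hdbar φ hφ h).graph) :
    ∃ c : ℂ, ‖u - c • oneL2 hφ h‖ ≤ 2 / h * Real.exp ((M - m) / h) * ‖v‖ := by
  obtain ⟨c, hc⟩ := (mem_graph_hdbar.1 huv).exists_eLpNorm_sub_const_le hh
    (memLp_volume hφ.continuous u) (memLp_volume hφ.continuous v)
  refine ⟨c, ?_⟩
  -- A bound between measures enters the `L²` norm through its square root, hence a loss of `e^{(M -
  -- m)/h}` and not of its square.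
  have hexp : ∀ a : ℝ, ENNReal.ofReal (Real.exp (2 * a)) ^ (1 / (2 : ℝ≥0∞)).toReal
      = ENNReal.ofReal (Real.exp a) := by
    intro a
    rw [ENNReal.ofReal_rpow_of_pos (Real.exp_pos _), ← Real.exp_mul]
    norm_num
    congr 2
    ring
  have h1 := eLpNorm_le_of_measure_le_smul (weightedMeasure_le_smul_volume hh hm)
    (f := fun z => u z - c) (p := 2)
  have h2 := eLpNorm_le_of_measure_le_smul (volume_le_smul_weightedMeasure hh hM)
    (f := v) (p := 2)
  rw [show -2 * m / h = 2 * (-m / h) by ring, hexp, smul_eq_mul] at h1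
  rw [show 2 * M / h = 2 * (M / h) by ring, hexp, smul_eq_mul] at h2
  have h3 : eLpNorm (u - c • oneL2 hφ h : L2phi φ h) 2 (weightedMeasure φ h)
      = eLpNorm (fun z => u z - c) 2 (weightedMeasure φ h) := by
    refine eLpNorm_congr_ae ?_
    filter_upwards [Lp.coeFn_sub u (c • oneL2 hφ h), Lp.coeFn_smul c (oneL2 hφ h),
      MemLp.coeFn_toLp (memLp_weightedMeasure hφ.continuous h (isSmooth_const 1).continuous)]
      with z e1 e2 e3
    rw [e1, Pi.sub_apply, e2, Pi.smul_apply, oneL2, e3, smul_eq_mul, mul_one]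
  have h4 : eLpNorm (fun z => u z - c) 2 (weightedMeasure φ h)
      ≤ ENNReal.ofReal (2 / h * Real.exp ((M - m) / h)) * eLpNorm v 2 (weightedMeasure φ h) := by
    calc _ ≤ ENNReal.ofReal (Real.exp (-m / h)) * (ENNReal.ofReal (2 / h) *
          (ENNReal.ofReal (Real.exp (M / h)) * eLpNorm v 2 (weightedMeasure φ h))) := by
          refine h1.trans ?_
          gcongr
          refine hc.trans ?_
          gcongr
      _ = _ := by
          rw [← mul_assoc, ← mul_assoc, ← ENNReal.ofReal_mul (Real.exp_nonneg _),
            ← ENNReal.ofReal_mul (by positivity),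
            show (M - m) / h = -m / h + M / h by ring, Real.exp_add]
          congr 2
          ring
  rw [Lp.norm_def, Lp.norm_def, h3,
    ← ENNReal.toReal_ofReal (r := 2 / h * Real.exp ((M - m) / h)) (by positivity),
    ← ENNReal.toReal_mul]
  exact ENNReal.toReal_mono (ENNReal.mul_ne_top ENNReal.ofReal_ne_top (Lp.eLpNorm_ne_top v)) h4

/-! ### Singular values of a densely defined operator -/

section SingularValues

variable {H : Type} [NormedAddCommGroup H] [InnerProductSpace ℂ H] [CompleteSpace H]
  {T : H →ₗ.[ℂ] H}

/-- Density matters here: it identifies the graph of `T.adjoint` with the adjoint of the graph of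
`T`. -/
theorem inner_eq_of_mem_adjoint_graph (hT : Dense (T.domain : Set H)) {a b v w : H}
    (hab : (a, b) ∈ T.graph) (hvw : (v, w) ∈ T.adjoint.graph) :
    inner ℂ b v = inner ℂ a w := by
  rw [LinearPMap.adjoint_graph_eq_graph_adjoint hT] at hvw
  exact sub_eq_zero.1 ((Submodule.mem_adjoint_iff _ _).1 hvw a b hab)

/-- `⟪v, v⟫ = ⟪T u, v⟫ = ⟪u, T* v⟫ = t² ‖u‖²`; the sign of `t` allows the square root. -/
theorem norm_eq_of_mem_adjoint_graph (hT : Dense (T.domain : Set H)) {u v : H} {t : ℝ}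
    (ht : 0 ≤ t) (huv : (u, v) ∈ T.graph) (hv : (v, ((t : ℂ) ^ 2) • u) ∈ T.adjoint.graph) :
    ‖v‖ = t * ‖u‖ := by
  have h1 := inner_eq_of_mem_adjoint_graph hT huv hv
  rw [inner_smul_right, inner_self_eq_norm_sq_to_K, inner_self_eq_norm_sq_to_K, ← mul_pow] at h1
  have h2 : ‖v‖ ^ 2 = (t * ‖u‖) ^ 2 := Complex.ofReal_injective (by push_cast; exact h1)
  exact (pow_left_inj₀ (norm_nonneg _) (by positivity) two_ne_zero).1 h2

/-- `t² ⟪e, u⟫ = ⟪e, T* v⟫ = ⟪T e, v⟫ = 0`. -/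
theorem inner_eq_zero_of_mem_singularSpace (hT : Dense (T.domain : Set H)) {e u : H} {t : ℝ}
    (ht : t ≠ 0) (he : (e, 0) ∈ T.graph) (hu : u ∈ singularSpace T t) : inner ℂ e u = 0 := by
  obtain ⟨v, -, hv⟩ := hu
  have h1 := inner_eq_of_mem_adjoint_graph hT he hv
  rw [inner_zero_left, inner_smul_right, eq_comm, mul_eq_zero] at h1
  exact h1.resolve_left (pow_ne_zero _ (Complex.ofReal_ne_zero.2 ht))

theorem mem_singularSpace_zero_iff (hT : Dense (T.domain : Set H)) {u : H} :
    u ∈ singularSpace T 0 ↔ (u, 0) ∈ T.graph := by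
  constructor
  · rintro ⟨v, huv, hv⟩
    have h1 := norm_eq_of_mem_adjoint_graph hT le_rfl huv hv
    rw [zero_mul, norm_eq_zero] at h1
    rwa [h1] at huv
  · exact fun hu => ⟨0, hu, by simp⟩

end SingularValues

/-! ### Small singular values of `h ∂̄` -/

theorem norm_le_norm_sub_smul {H : Type*} [NormedAddCommGroup H] [InnerProductSpace ℂ H]
    {e u : H} (he : inner ℂ e u = 0) (c : ℂ) : ‖u‖ ≤ ‖u - c • e‖ := by
  have h0 : inner ℂ u (c • e) = 0 := by rw [inner_smul_right, inner_eq_zero_symm.1 he, mul_zero]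
  have h1 := norm_sub_sq (𝕜 := ℂ) u (c • e)
  rw [h0, map_zero, mul_zero, sub_zero] at h1
  refine le_of_sq_le_sq ?_ (norm_nonneg _)
  rw [h1]
  exact le_add_of_nonneg_right (sq_nonneg _)

theorem singularSpace_hdbar_zero {φ : Torus → ℝ} (hφ : IsSmooth φ) {h m M : ℝ} (hh : 0 < h)
    (hm : ∀ z, m ≤ φ z) (hM : ∀ z, φ z ≤ M) :
    singularSpace (hdbar φ hφ h) 0 = Submodule.span ℂ {oneL2 hφ h} := by
  ext u
  rw [mem_singularSpace_zero_iff (dense_domain_hdbar hφ h), Submodule.mem_span_singleton]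
  constructor
  · intro hu
    obtain ⟨c, hc⟩ := exists_norm_sub_smul_oneL2_le hφ hh hm hM hu
    rw [norm_zero, mul_zero, norm_le_zero_iff, sub_eq_zero] at hc
    exact ⟨c, hc.symm⟩
  · rintro ⟨c, rfl⟩
    simpa using (hdbar φ hφ h).graph.smul_mem c (oneL2_mem_graph hφ h)

/-- The Poincaré constant `c` is an unweighted mean, not the projection in `L²_φ`. This is harmless,
since orthogonality to `1` gives `‖u‖ ≤ ‖u - c‖` for every `c`. -/
theorem singularSpace_hdbar_eq_bot {φ : Torus → ℝ} (hφ : IsSmooth φ) {h m M t : ℝ} (hh : 0 < h)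
    (hm : ∀ z, m ≤ φ z) (hM : ∀ z, φ z ≤ M) (ht : 0 < t)
    (hlt : 2 / h * Real.exp ((M - m) / h) * t < 1) :
    singularSpace (hdbar φ hφ h) t = ⊥ := by
  rw [Submodule.eq_bot_iff]
  intro u hu
  have horth := inner_eq_zero_of_mem_singularSpace (dense_domain_hdbar hφ h) ht.ne'
    (oneL2_mem_graph hφ h) hu
  obtain ⟨v, huv, hv⟩ := hu
  obtain ⟨c, hc⟩ := exists_norm_sub_smul_oneL2_le hφ hh hm hM huv
  rw [norm_eq_of_mem_adjoint_graph (dense_domain_hdbar hφ h) ht.le huv hv, ← mul_assoc] at hc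
  have h1 := (norm_le_norm_sub_smul horth c).trans hc
  by_contra hne
  exact absurd h1 (not_le.2 (mul_lt_of_lt_one_left (norm_pos_iff.2 hne) hlt))

theorem two_div_mul_exp_neg_lt_one {δ h : ℝ} (hδ : 0 < δ) (hh : 0 < h) (hlt : h < δ ^ 2 / 4) :
    2 / h * Real.exp (-δ / h) < 1 := by
  -- The quadratic term of `e^{δ/h}` suffices: `2/h < (δ/h)²/2` is exactly `h < δ²/4`.
  have h1 := Real.quadratic_le_exp_of_nonneg (x := δ / h) (by positivity)
  have h2 : 2 / h < Real.exp (δ / h) := by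
    have h3 : 2 / h < (δ / h) ^ 2 / 2 := by
      rw [div_pow, div_div, div_lt_div_iff₀ hh (by positivity)]
      nlinarith
    have : 0 < δ / h := by positivity
    linarith
  rw [neg_div, Real.exp_neg, ← div_eq_mul_inv, div_lt_one (Real.exp_pos _)]
  exact h2

end DbarTorus

theorem theoremA1 (φ : DbarTorus.Torus → ℝ) (hφ : DbarTorus.IsSmooth φ) (τ : ℝ)
    (hτ : (⨆ z, φ z) - (⨅ z, φ z) < τ) :
    ∃ h₀ : ℝ, 0 < h₀ ∧ ∀ h : ℝ, 0 < h → h < h₀ →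
      {t : ℝ | DbarTorus.IsSingularValue (DbarTorus.hdbar φ hφ h) t} ∩
          Set.Icc 0 (Real.exp (-τ / h)) = {0} ∧
        Module.finrank ℂ (DbarTorus.singularSpace (DbarTorus.hdbar φ hφ h) 0) = 1 := by
  set M := ⨆ z, φ z
  set m := ⨅ z, φ z
  have hM : ∀ z, φ z ≤ M := le_ciSup (isCompact_range hφ.continuous).bddAbove
  have hm : ∀ z, m ≤ φ z := ciInf_le (isCompact_range hφ.continuous).bddBelow
  have hδ : 0 < τ - (M - m) := sub_pos.2 hτ
  -- This is the threshold of `two_div_mul_exp_neg_lt_one` with `δ = τ - (M - m)`, the exponent left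
  -- after the weight loss is absorbed by `e^{-τ/h}`.
  refine ⟨(τ - (M - m)) ^ 2 / 4, by positivity, fun h hh hlt => ?_⟩
  have h0 := DbarTorus.singularSpace_hdbar_zero hφ hh hm hM
  have h1 := finrank_span_singleton (K := ℂ) (DbarTorus.oneL2_ne_zero hφ h)
  refine ⟨?_, by rw [h0, h1]⟩
  refine Set.eq_singleton_iff_unique_mem.2 ⟨⟨⟨le_rfl, ?_⟩, le_rfl, (Real.exp_pos _).le⟩, ?_⟩
  · rw [h0, Ne, Submodule.span_singleton_eq_bot]
    exact DbarTorus.oneL2_ne_zero hφ h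
  · rintro t ⟨⟨ht, hne⟩, -, hle⟩
    by_contra ht0
    refine hne (DbarTorus.singularSpace_hdbar_eq_bot hφ hh hm hM (lt_of_le_of_ne' ht ht0) ?_)
    calc 2 / h * Real.exp ((M - m) / h) * t
        ≤ 2 / h * Real.exp ((M - m) / h) * Real.exp (-τ / h) := by gcongr
      _ = 2 / h * Real.exp (-(τ - (M - m)) / h) := by
          rw [mul_assoc, ← Real.exp_add]
          congr 2
          ring
      _ < 1 := DbarTorus.two_div_mul_exp_neg_lt_one hδ hh hlt
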